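/- Let $\mathbb D$ be the open unit disk, and let $H^2$ be the Hardy space over the bidisk $\mathbb D^2$, with reproducing kernels $k_\lambda(z)=\frac{1}{(1-\overline{\lambda_1}z_1)(1-\overline{\lambda_2}z_2)}$ $(\lambda\in\mathbb D^2)$. Let $\mathcal D\subset H^2$ be the linear span of all $k_\lambda$, $\lambda\in\mathbb D^2$. For $f\in H^2$ let $T_f$ be the (possibly unbounded) operator of multiplication by $f$ in $H^2$ with domain $\mathcal D$; its adjoint $T_f^*$ is defined on $\mathcal D$ and maps $\mathcal D$ into $\mathcal D$. Let $\mathcal Q(\mathbb D^2;2,1)$ be the set of all triples $(\varphi_1,\varphi_2,\varphi_3)$ of holomorphic functions in $H^2$ such that $$I-T_{\varphi_1}T_{\varphi_1}^*-T_{\varphi_2}T_{\varphi_2}^*+T_{\varphi_3}T_{\varphi_3}^*\ge 0\quad\text{on }\mathcal D,$$ that is, the quadratic form of this operator is non-negative on $\mathcal D$. For $z=(z_1,z_2)$ and $w=(w_1,w_2)$ in $\mathbb D^2$ put $b_{w_j}(z_j)=\frac{z_j-w_j}{1-\overline{w_j}z_j}$ and $$d(z,w)=\sqrt{|b_{w_1}(z_1)|^2+|b_{w_2}(z_2)|^2-|b_{w_1}(z_1)\,b_{w_2}(z_2)|^2}.$$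 Theorem. Let $\psi=(\psi_1,\psi_2)$ be a holomorphic self-map of $\mathbb D^2$ such that $(\psi_1,\psi_2,\psi_1\psi_2)$ belongs to $\mathcal Q(\mathbb D^2;2,1)$. Then $$0\le d(\psi(z),\psi(w))\le d(z,w)<1\qquad\text{for all } z,w\in\mathbb D^2.$$ Moreover, if for some $w\in\mathbb D^2$ the equality $d(\psi(z),\psi(w))=d(z,w)$ holds for all $z$ in some non-empty open set $V\subseteq\mathbb D^2$, then $\psi$ belongs to $\operatorname{Aut}(\mathbb D^2)$, that is, $\psi$ is a bijection of $\mathbb D^2$ onto itself with holomorphic inverse. -/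

import Mathlib

open scoped InnerProductSpace LinearPMap ComplexConjugate ENNReal

namespace BidiskHardy

/-- The open unit bidisk `𝔻² = 𝔻 × 𝔻` in `ℂ²`. -/
def bidisk : Set (ℂ × ℂ) := {z | ‖z.1‖ < 1 ∧ ‖z.2‖ < 1}

/-- The Hardy space `H²` over the bidisk: the Hilbert space of all power series
`∑ a (m, n) z₁ ^ m z₂ ^ n` with `∑ |a (m, n)|² < ∞`. An element is stored as its family of Taylor
coefficients; `eval` gives the function on the bidisk. -/
abbrev H2 : Type := lp (fun _ : ℕ × ℕ => ℂ) 2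

/-- The value at `z` of the function with Taylor coefficients `f`. -/
noncomputable def eval (f : H2) (z : ℂ × ℂ) : ℂ := ∑' p : ℕ × ℕ, f p * (z.1 ^ p.1 * z.2 ^ p.2)

theorem summable_geom {x y : ℂ} (hx : ‖x‖ < 1) (hy : ‖y‖ < 1) :
    Summable fun p : ℕ × ℕ => ‖x ^ p.1 * y ^ p.2‖ := by
  have h := (summable_geometric_of_lt_one (norm_nonneg x) hx).mul_of_nonneg
    (summable_geometric_of_lt_one (norm_nonneg y) hy)
    (fun n => by positivity) (fun n => by positivity)
  simpa using h

theorem memlp_kernel (l : bidisk) :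
    Memℓp (fun p : ℕ × ℕ => conj (l : ℂ × ℂ).1 ^ p.1 * conj (l : ℂ × ℂ).2 ^ p.2) (2 : ℝ≥0∞) := by
  apply memℓp_gen
  have h := summable_geom (x := conj (l : ℂ × ℂ).1 ^ 2) (y := conj (l : ℂ × ℂ).2 ^ 2)
    (by simpa using pow_lt_one₀ (norm_nonneg _) l.2.1 two_ne_zero)
    (by simpa using pow_lt_one₀ (norm_nonneg _) l.2.2 two_ne_zero)
  refine h.congr fun p => ?_
  simp [mul_pow, ← pow_mul, mul_comm]

/-- The reproducing kernel `k_l` of `H²` at a point `l` of the bidisk, that is, the function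
`k_l(z) = 1 / ((1 - conj l₁ z₁) (1 - conj l₂ z₂))`; see `eval_kernel` and `eval_eq_inner`. -/
noncomputable def kernel (l : bidisk) : H2 :=
  ⟨fun p => conj (l : ℂ × ℂ).1 ^ p.1 * conj (l : ℂ × ℂ).2 ^ p.2, memlp_kernel l⟩

theorem kernel_apply (l : bidisk) (p : ℕ × ℕ) :
    kernel l p = conj (l : ℂ × ℂ).1 ^ p.1 * conj (l : ℂ × ℂ).2 ^ p.2 := rfl

theorem hasSum_eval_inner (f : H2) (l : bidisk) :
    HasSum (fun p : ℕ × ℕ => f p * ((l : ℂ × ℂ).1 ^ p.1 * (l : ℂ × ℂ).2 ^ p.2))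
      (⟪kernel l, f⟫_ℂ) := by
  have h := lp.hasSum_inner (𝕜 := ℂ) (kernel l) f
  simpa [kernel_apply] using h

theorem eval_eq_inner (f : H2) (l : bidisk) : eval f l = ⟪kernel l, f⟫_ℂ :=
  (hasSum_eval_inner f l).tsum_eq

theorem hasSum_eval (f : H2) (l : bidisk) :
    HasSum (fun p : ℕ × ℕ => f p * ((l : ℂ × ℂ).1 ^ p.1 * (l : ℂ × ℂ).2 ^ p.2)) (eval f l) := by
  rw [eval_eq_inner]; exact hasSum_eval_inner f l

theorem eval_kernel (l z : bidisk) :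
    eval (kernel l) z = 1 / ((1 - conj (l : ℂ × ℂ).1 * (z : ℂ × ℂ).1) *
      (1 - conj (l : ℂ × ℂ).2 * (z : ℂ × ℂ).2)) := by
  have hx : ‖conj (l : ℂ × ℂ).1 * (z : ℂ × ℂ).1‖ < 1 := by
    simpa using mul_lt_one_of_nonneg_of_lt_one_left (norm_nonneg _) l.2.1 z.2.1.le
  have hy : ‖conj (l : ℂ × ℂ).2 * (z : ℂ × ℂ).2‖ < 1 := by
    simpa using mul_lt_one_of_nonneg_of_lt_one_left (norm_nonneg _) l.2.2 z.2.2.le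
  have h := (hasSum_geometric_of_norm_lt_one hx).mul (hasSum_geometric_of_norm_lt_one hy)
    (summable_geom hx hy).of_norm
  rw [one_div, mul_inv, ← h.tsum_eq]
  unfold eval
  congr 1
  funext p
  rw [kernel_apply, mul_pow, mul_pow]
  ring

theorem coeff_zero_of_sum_zero (a : ℕ → ℂ)
    (h : ∀ x : ℂ, ‖x‖ < 1 → HasSum (fun n => a n * x ^ n) 0) : a = 0 := by
  have hs : Summable fun n => a n * (1 / 2 : ℂ) ^ n := (h (1 / 2) (by norm_num)).summable
  obtain ⟨C, hC⟩ := hs.tendsto_atTop_zero.norm.bddAbove_range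
  set p := FormalMultilinearSeries.ofScalars ℂ a with hp
  have hr : ((1 / 2 : NNReal) : ℝ≥0∞) ≤ p.radius := by
    refine p.le_radius_of_bound C fun n => ?_
    have h1 := hC ⟨n, rfl⟩
    have h2 : ‖p n‖ = ‖a n‖ := by
      rw [hp, FormalMultilinearSeries.ofScalars_norm]
    rw [h2]
    simpa using h1
  have hpos : 0 < p.radius := lt_of_lt_of_le (by norm_num) hr
  have hf := (p.hasFPowerSeriesOnBall hpos).hasFPowerSeriesAt
  have hz : p = 0 := by
    apply hf.eq_zero_of_eventually
    filter_upwards [Metric.ball_mem_nhds (0 : ℂ) one_pos] with x hx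
    have hx' := (h x (by simpa using hx)).tsum_eq
    simpa [FormalMultilinearSeries.sum, hp, FormalMultilinearSeries.ofScalars_apply_eq, mul_comm] using hx'
  exact (FormalMultilinearSeries.ofScalars_series_eq_zero ℂ).1 hz

theorem eq_zero_of_eval (f : H2) (h : ∀ z : bidisk, eval f z = 0) : f = 0 := by
  have h1 : ∀ y : ℂ, ‖y‖ < 1 → ∀ m : ℕ, ∑' n, f (m, n) * y ^ n = 0 := by
    intro y hy m
    have := coeff_zero_of_sum_zero (fun m => ∑' n, f (m, n) * y ^ n) fun x hx => by
      have hs := hasSum_eval f ⟨(x, y), hx, hy⟩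
      rw [h] at hs
      have hf := hs.summable.prod_factor
      have := hs.prod_fiberwise fun m => (hf m).hasSum
      refine this.congr_fun ?_
      intro m
      simp only
      rw [← tsum_mul_right]
      congr 1
      funext n
      ring
    exact congrFun this m
  ext p
  obtain ⟨m, n⟩ := p
  have := coeff_zero_of_sum_zero (fun n => f (m, n)) fun y hy => by
    have hs := (hasSum_eval f ⟨(1 / 2, y), by norm_num, hy⟩).summable.prod_factor m
    have hs' : Summable fun n => f (m, n) * y ^ n := by
      refine (hs.mul_left ((2 : ℂ) ^ m)).congr fun n => ?_
      simp only
      have : (2 : ℂ) ^ m * (1 / 2) ^ m = 1 := by rw [← mul_pow]; norm_num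
      linear_combination (f (m, n) * y ^ n) * this
    rw [← h1 y hy m]
    exact hs'.hasSum
  simpa using congrFun this n

/-- The linear space `𝓓` of all finite linear combinations of reproducing kernels. -/
noncomputable def kernelSpan : Submodule ℂ H2 := Submodule.span ℂ (Set.range kernel)

theorem dense_kernelSpan : Dense (kernelSpan : Set H2) := by
  rw [Submodule.dense_iff_topologicalClosure_eq_top, Submodule.topologicalClosure_eq_top_iff,
    Submodule.eq_bot_iff]
  intro f hf
  refine eq_zero_of_eval f fun z => ?_
  rw [eval_eq_inner]
  exact (Submodule.mem_orthogonal _ _).1 hf _ (Submodule.subset_span ⟨z, rfl⟩)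

theorem eval_add (f g : H2) (z : bidisk) : eval (f + g) z = eval f z + eval g z := by
  simp only [eval_eq_inner, inner_add_right]

theorem eval_smul (c : ℂ) (f : H2) (z : bidisk) : eval (c • f) z = c * eval f z := by
  simp only [eval_eq_inner, inner_smul_right]

theorem eval_injective {f g : H2} (h : ∀ z : bidisk, eval f z = eval g z) : f = g := by
  refine sub_eq_zero.1 (eq_zero_of_eval _ fun z => ?_)
  rw [eval_eq_inner, inner_sub_right, ← eval_eq_inner, ← eval_eq_inner, h, sub_self]

theorem exists_monomial_mul (f : H2) (q : ℕ × ℕ) : ∃ g : H2, ‖g‖ = ‖f‖ ∧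
    ∀ z : bidisk, eval g z = ((z : ℂ × ℂ).1 ^ q.1 * (z : ℂ × ℂ).2 ^ q.2) * eval f z := by
  have hinj : Function.Injective fun p : ℕ × ℕ => p + q := add_left_injective q
  have hn : (fun p => ‖Function.extend (fun p : ℕ × ℕ => p + q) f 0 p‖ ^ (2 : ℝ≥0∞).toReal) =
      Function.extend (fun p : ℕ × ℕ => p + q) (fun p => ‖f p‖ ^ (2 : ℝ≥0∞).toReal) 0 := by
    funext p
    by_cases hp : ∃ p', p' + q = p
    · obtain ⟨p', rfl⟩ := hp
      rw [hinj.extend_apply, hinj.extend_apply]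
    · rw [Function.extend_apply' _ _ _ hp, Function.extend_apply' _ _ _ hp]
      simp
  have hmem : Memℓp (Function.extend (fun p : ℕ × ℕ => p + q) f 0) (2 : ℝ≥0∞) := by
    apply memℓp_gen
    rw [hn, summable_extend_zero hinj]
    exact (memℓp_gen_iff (by norm_num)).1 (lp.memℓp f)
  refine ⟨⟨_, hmem⟩, ?_, fun z => ?_⟩
  · have h1 := lp.norm_rpow_eq_tsum (p := 2) (by norm_num) f
    have h2 := lp.norm_rpow_eq_tsum (p := 2) (by norm_num) (⟨_, hmem⟩ : H2)
    rw [hn, tsum_extend_zero hinj, ← h1] at h2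
    exact (Real.rpow_left_inj (norm_nonneg _) (norm_nonneg _) (by norm_num)).1 h2
  · unfold eval
    rw [← tsum_mul_left]
    refine Eq.trans ?_ (tsum_extend_zero hinj _)
    congr 1
    funext p
    by_cases hp : ∃ p', p' + q = p
    · obtain ⟨p', rfl⟩ := hp
      rw [hinj.extend_apply]
      change Function.extend (fun p : ℕ × ℕ => p + q) f 0 ((fun p => p + q) p') * _ = _
      rw [hinj.extend_apply]
      simp only [Prod.fst_add, Prod.snd_add, pow_add]
      ring
    · rw [Function.extend_apply' _ _ _ hp]
      change Function.extend (fun p : ℕ × ℕ => p + q) f 0 p * _ = _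
      rw [Function.extend_apply' _ _ _ hp]
      simp

theorem exists_mul_kernel (f : H2) (l : bidisk) : ∃ g : H2,
    ∀ z : bidisk, eval g z = eval f z * eval (kernel l) z := by
  choose S hS hS' using exists_monomial_mul f
  have hsum : Summable fun q => kernel l q • S q := by
    refine Summable.of_norm ?_
    have := (summable_geom (x := conj (l : ℂ × ℂ).1) (y := conj (l : ℂ × ℂ).2)
      (by simpa using l.2.1) (by simpa using l.2.2)).mul_right ‖f‖
    refine this.congr fun q => ?_
    rw [norm_smul, hS, kernel_apply]
  refine ⟨∑' q, kernel l q • S q, fun z => ?_⟩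
  rw [eval_eq_inner, ← innerSL_apply_apply ℂ, (innerSL ℂ (kernel z)).map_tsum hsum]
  conv_rhs => unfold eval
  rw [← eval, ← tsum_mul_left]
  congr 1
  funext q
  rw [innerSL_apply_apply, ← eval_eq_inner, eval_smul, hS']
  ring

theorem exists_mul (f : H2) (h : kernelSpan) : ∃ g : H2,
    ∀ z : bidisk, eval g z = eval f z * eval h z := by
  obtain ⟨h, hh⟩ := h
  induction hh using Submodule.span_induction with
  | mem x hx =>
    obtain ⟨l, rfl⟩ := hx
    exact exists_mul_kernel f l
  | zero => exact ⟨0, fun z => by simp [eval_eq_inner]⟩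
  | add x y _ _ hx hy =>
    obtain ⟨g₁, h₁⟩ := hx
    obtain ⟨g₂, h₂⟩ := hy
    exact ⟨g₁ + g₂, fun z => by simp only [eval_add, h₁, h₂, mul_add]⟩
  | smul c x _ hx =>
    obtain ⟨g, hg⟩ := hx
    exact ⟨c • g, fun z => by simp only [eval_smul, hg]; ring⟩

/-- The product `f h` in `H²` of `f ∈ H²` and `h ∈ 𝓓`. -/
noncomputable def mul (f : H2) (h : kernelSpan) : H2 := (exists_mul f h).choose

theorem eval_mul (f : H2) (h : kernelSpan) (z : bidisk) :
    eval (mul f h) z = eval f z * eval h z := (exists_mul f h).choose_spec z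

/-- The Toeplitz operator `T_f` with symbol `f ∈ H²`: the (possibly unbounded) operator of
multiplication by `f` in `H²`, with domain `𝓓`. -/
noncomputable def toeplitz (f : H2) : H2 →ₗ.[ℂ] H2 where
  domain := kernelSpan
  toFun :=
    { toFun := mul f
      map_add' := fun g h => eval_injective fun z => by
        simp only [eval_mul, eval_add, Submodule.coe_add, mul_add]
      map_smul' := fun c h => eval_injective fun z => by
        simp only [eval_mul, eval_smul, Submodule.coe_smul, RingHom.id_apply]; ring }

theorem toeplitz_inner_kernel (f : H2) (l : bidisk) (x : (toeplitz f).domain) :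
    ⟪conj (eval f l) • kernel l, (x : H2)⟫_ℂ = ⟪kernel l, toeplitz f x⟫_ℂ := by
  rw [inner_smul_left, Complex.conj_conj, ← eval_eq_inner, ← eval_eq_inner]
  exact (eval_mul f x l).symm

theorem adjoint_kernel (f : H2) (l : bidisk) : ∃ h : kernel l ∈ ((toeplitz f)†).domain,
    ((toeplitz f)†) ⟨kernel l, h⟩ = conj (eval f l) • kernel l := by
  have h : kernel l ∈ ((toeplitz f)†).domain :=
    LinearPMap.mem_adjoint_domain_of_exists _ ⟨_, toeplitz_inner_kernel f l⟩
  exact ⟨h, LinearPMap.adjoint_apply_eq dense_kernelSpan _ (toeplitz_inner_kernel f l)⟩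

theorem kernelSpan_le_adjoint_domain (f : H2) : kernelSpan ≤ ((toeplitz f)†).domain := by
  refine Submodule.span_le.2 ?_
  rintro _ ⟨l, rfl⟩
  exact (adjoint_kernel f l).1

theorem adjoint_mem_kernelSpan (f : H2) (h : kernelSpan) :
    ((toeplitz f)†) ⟨h, kernelSpan_le_adjoint_domain f h.2⟩ ∈ kernelSpan := by
  have key : kernelSpan ≤ (kernelSpan.comap ((toeplitz f)†).toFun).map
      ((toeplitz f)†).domain.subtype := by
    refine Submodule.span_le.2 ?_
    rintro _ ⟨l, rfl⟩
    obtain ⟨hl, e⟩ := adjoint_kernel f l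
    refine ⟨⟨kernel l, hl⟩, ?_, rfl⟩
    change ((toeplitz f)†) ⟨kernel l, hl⟩ ∈ kernelSpan
    rw [e]
    exact kernelSpan.smul_mem _ (Submodule.subset_span ⟨l, rfl⟩)
  obtain ⟨x, hx, hxh⟩ := key h.2
  have : x = ⟨h, kernelSpan_le_adjoint_domain f h.2⟩ := Subtype.ext hxh
  rw [← this]
  exact hx

/-- `T_f T_f^*` on `𝓓`: the Hilbert space adjoint `T_f^*` maps `𝓓` into `𝓓`, and `T_f` is
applied to the result. -/
noncomputable def toeplitzSelf (f : H2) (h : kernelSpan) : H2 :=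
  toeplitz f ⟨((toeplitz f)†) ⟨h, kernelSpan_le_adjoint_domain f h.2⟩, adjoint_mem_kernelSpan f h⟩

/-- `φ` is, on the bidisk, the function in `H²` with Taylor coefficients `f`. -/
def Represents (f : H2) (φ : ℂ × ℂ → ℂ) : Prop := ∀ z ∈ bidisk, φ z = eval f z

/-- The class `𝒬(𝔻²; 2, 1)`: triples of holomorphic functions in `H²` over the bidisk with
`I - T_{φ₁} T_{φ₁}^* - T_{φ₂} T_{φ₂}^* + T_{φ₃} T_{φ₃}^* ≥ 0` on `𝓓`. -/
def ClassQ (φ₁ φ₂ φ₃ : ℂ × ℂ → ℂ) : Prop :=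
  DifferentiableOn ℂ φ₁ bidisk ∧ DifferentiableOn ℂ φ₂ bidisk ∧ DifferentiableOn ℂ φ₃ bidisk ∧
  ∃ f₁ f₂ f₃ : H2, Represents f₁ φ₁ ∧ Represents f₂ φ₂ ∧ Represents f₃ φ₃ ∧
    ∀ h : kernelSpan, 0 ≤
      (⟪(h : H2) - toeplitzSelf f₁ h - toeplitzSelf f₂ h + toeplitzSelf f₃ h, (h : H2)⟫_ℂ).re

/-- `ψ` is a holomorphic self-map of the bidisk. -/
def IsHolSelfMap (ψ : ℂ × ℂ → ℂ × ℂ) : Prop :=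
  DifferentiableOn ℂ ψ bidisk ∧ Set.MapsTo ψ bidisk bidisk

/-- `ψ` is (on the bidisk) an element of `Aut(𝔻²)`: a holomorphic self-map of the bidisk with a
holomorphic inverse. -/
def IsAut (ψ : ℂ × ℂ → ℂ × ℂ) : Prop :=
  IsHolSelfMap ψ ∧ ∃ χ : ℂ × ℂ → ℂ × ℂ, IsHolSelfMap χ ∧ Set.InvOn χ ψ bidisk bidisk

/-- The Blaschke factor `b_w(z) = (z - w) / (1 - conj w z)`. -/
noncomputable def blaschke (w z : ℂ) : ℂ := (z - w) / (1 - conj w * z)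

/-- The function `d(z, w)` on the bidisk. -/
noncomputable def dist₂ (z w : ℂ × ℂ) : ℝ :=
  Real.sqrt (‖blaschke w.1 z.1‖ ^ 2 + ‖blaschke w.2 z.2‖ ^ 2
    - ‖blaschke w.1 z.1 * blaschke w.2 z.2‖ ^ 2)

end BidiskHardy

/-! Write `s` for `szego`, the reciprocal of the reproducing kernel, and `K(z, w) = s(ψ z, ψ w) /
s(z, w)`. The kernels are eigenvectors of every `T_f^*`, and `1 - x₁ȳ₁ - x₂ȳ₂ + x₁x₂ȳ₁ȳ₂` factors as
`s(x, y)`. Hence membership of `(ψ₁, ψ₂, ψ₁ψ₂)` in the class makes `K` a positive kernel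
(`ClassQ.posSemidef`).

Since `1 - d(z, w)² = s(z, z) s(w, w) / |s(z, w)|²`, the inequality between the distances is the
Cauchy–Schwarz inequality `|K(z, w)|² ≤ K(z, z) K(w, w)`.

Equality for `z` in an open set makes the 2 × 2 minors degenerate. Positivity and the identity
theorem then give `K(z, u) K(w, w) = K(z, w) K(w, u)` on the whole bidisk
(`quotientKernel_rank_one`). After automorphisms move `w` and `ψ w` to the origin, this says that
the normalised map `φ` preserves `s`. As `1 - s` is a nondegenerate Hermitian form in the monomials
`z₁, z₂, z₁z₂`, these monomials of `φ` are linear in those of `z`. Because the third is the product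
of the first two, `φ` can only be a rotation, possibly composed with the swap of coordinates
(`eq_diagonal_or_swap_of_szego_eq`). -/

namespace BidiskHardy

/-! ### The reciprocal kernel and the quotient kernel -/

/-- The reciprocal of the reproducing kernel, `(1 - u₁ conj v₁) (1 - u₂ conj v₂)`. -/
noncomputable def szego (u v : ℂ × ℂ) : ℂ := (1 - u.1 * conj v.1) * (1 - u.2 * conj v.2)

/-- The de Branges–Rovnyak type kernel `szego (ψ z) (ψ w) / szego z w` of a self-map `ψ`. -/
noncomputable def quotientKernel (ψ : ℂ × ℂ → ℂ × ℂ) (z w : ℂ × ℂ) : ℂ :=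
  szego (ψ z) (ψ w) / szego z w

theorem conj_szego (u v : ℂ × ℂ) : conj (szego u v) = szego v u := by
  simp [szego, mul_comm]

theorem conj_quotientKernel (ψ : ℂ × ℂ → ℂ × ℂ) (z w : ℂ × ℂ) :
    conj (quotientKernel ψ z w) = quotientKernel ψ w z := by
  simp [quotientKernel, conj_szego]

theorem one_sub_mul_conj_ne_zero {x y : ℂ} (hx : ‖x‖ < 1) (hy : ‖y‖ < 1) :
    1 - x * conj y ≠ 0 := by
  intro h
  have h1 : ‖x * conj y‖ = 1 := by rw [← sub_eq_zero.1 h, norm_one]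
  rw [norm_mul, RCLike.norm_conj] at h1
  nlinarith [norm_nonneg x, norm_nonneg y]

theorem szego_ne_zero {u v : ℂ × ℂ} (hu : u ∈ bidisk) (hv : v ∈ bidisk) : szego u v ≠ 0 :=
  mul_ne_zero (one_sub_mul_conj_ne_zero hu.1 hv.1) (one_sub_mul_conj_ne_zero hu.2 hv.2)

theorem szego_self (u : ℂ × ℂ) :
    szego u u = (((1 - ‖u.1‖ ^ 2) * (1 - ‖u.2‖ ^ 2) : ℝ) : ℂ) := by
  simp [szego, Complex.mul_conj']

theorem szego_self_pos {u : ℂ × ℂ} (hu : u ∈ bidisk) :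
    0 < (1 - ‖u.1‖ ^ 2) * (1 - ‖u.2‖ ^ 2) := by
  have h1 : ‖u.1‖ ^ 2 < 1 := pow_lt_one₀ (norm_nonneg _) hu.1 two_ne_zero
  have h2 : ‖u.2‖ ^ 2 < 1 := pow_lt_one₀ (norm_nonneg _) hu.2 two_ne_zero
  exact mul_pos (by linarith) (by linarith)

theorem eval_kernel_eq_inv_szego (l z : bidisk) :
    eval (kernel l) z = (szego (z : ℂ × ℂ) l)⁻¹ := by
  rw [eval_kernel, one_div, szego]
  congr 2 <;> ring

/-! ### Positivity of the quotient kernel -/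

theorem eval_sum {ι : Type*} (s : Finset ι) (f : ι → H2) (z : bidisk) :
    eval (∑ i ∈ s, f i) z = ∑ i ∈ s, eval (f i) z := by
  simp only [eval_eq_inner, inner_sum]

theorem sum_smul_kernel_mem {ι : Type*} [Fintype ι] (c : ι → ℂ) (x : ι → bidisk) :
    ∑ i, c i • kernel (x i) ∈ kernelSpan :=
  Submodule.sum_mem _ fun i _ => Submodule.smul_mem _ _ (Submodule.subset_span ⟨x i, rfl⟩)

theorem adjoint_sum_smul_kernel {ι : Type*} [Fintype ι] (f : H2) (c : ι → ℂ) (x : ι → bidisk)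
    (h : ∑ i, c i • kernel (x i) ∈ ((toeplitz f)†).domain) :
    ((toeplitz f)†) ⟨∑ i, c i • kernel (x i), h⟩ =
      ∑ i, (c i * conj (eval f (x i))) • kernel (x i) := by
  refine LinearPMap.adjoint_apply_eq dense_kernelSpan _ fun y => ?_
  simp only [sum_inner, mul_smul, inner_smul_left (𝕜 := ℂ) _ _ (c _)]
  exact Finset.sum_congr rfl fun i _ => by rw [toeplitz_inner_kernel]

theorem eval_toeplitzSelf {ι : Type*} [Fintype ι] (f : H2) (c : ι → ℂ) (x : ι → bidisk)
    (z : bidisk) :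
    eval (toeplitzSelf f ⟨_, sum_smul_kernel_mem c x⟩) z =
      ∑ i, c i * (eval f z * conj (eval f (x i)) * eval (kernel (x i)) z) := by
  refine (eval_mul f _ z).trans ?_
  simp only [adjoint_sum_smul_kernel, eval_sum, eval_smul, Finset.mul_sum]
  exact Finset.sum_congr rfl fun i _ => by ring

/-- This is the operator inequality tested on `∑ c i • k_{x i}`. By the eigenvector relation its
kernel is `1 - ψ₁ψ₁* - ψ₂ψ₂* + ψ₁ψ₂(ψ₁ψ₂)*` divided by `szego`, and the choice of `ψ₁ψ₂` as third
symbol is what lets the numerator factor. -/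
theorem ClassQ.sum_nonneg {ψ : ℂ × ℂ → ℂ × ℂ}
    (hQ : ClassQ (fun z => (ψ z).1) (fun z => (ψ z).2) (fun z => (ψ z).1 * (ψ z).2))
    {ι : Type*} [Fintype ι] (c : ι → ℂ) (x : ι → bidisk) :
    0 ≤ (∑ j, ∑ i, conj (c j) * (c i * quotientKernel ψ (x j) (x i))).re := by
  obtain ⟨-, -, -, f₁, f₂, f₃, h₁, h₂, h₃, hA⟩ := hQ
  have h := hA ⟨_, sum_smul_kernel_mem c x⟩
  -- Conjugation leaves the real part unchanged and moves the test vector to the first slot, where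
  -- pairing with a kernel is evaluation.
  rw [← Complex.conj_re, inner_conj_symm, sum_inner] at h
  convert h using 3 with j
  rw [inner_smul_left, ← eval_eq_inner, ← Finset.mul_sum]
  congr 1
  have hsub : ∀ g g' : H2, eval (g - g') (x j) = eval g (x j) - eval g' (x j) := fun g g' => by
    simp only [eval_eq_inner, inner_sub_right]
  simp only [eval_add, hsub, eval_toeplitzSelf]
  simp only [eval_sum, eval_smul, ← Finset.sum_sub_distrib, ← Finset.sum_add_distrib]
  refine Finset.sum_congr rfl fun i _ => ?_
  rw [← h₁ _ (x j).2, ← h₁ _ (x i).2, ← h₂ _ (x j).2, ← h₂ _ (x i).2, ← h₃ _ (x j).2,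
    ← h₃ _ (x i).2, eval_kernel_eq_inv_szego, quotientKernel, div_eq_mul_inv]
  simp only [szego, map_mul]
  ring

open scoped ComplexOrder in
theorem ClassQ.posSemidef {ψ : ℂ × ℂ → ℂ × ℂ}
    (hQ : ClassQ (fun z => (ψ z).1) (fun z => (ψ z).2) (fun z => (ψ z).1 * (ψ z).2))
    {ι : Type*} [Fintype ι] (x : ι → bidisk) :
    (Matrix.of fun j i => quotientKernel ψ (x j) (x i)).PosSemidef := by
  have hH : (Matrix.of fun j i => quotientKernel ψ (x j) (x i)).IsHermitian := by
    ext j i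
    simp [Matrix.conjTranspose_apply, conj_quotientKernel]
  refine Matrix.posSemidef_iff_dotProduct_mulVec.2 ⟨hH, fun c => ?_⟩
  refine Complex.nonneg_iff.2 ⟨?_, (hH.im_star_dotProduct_mulVec_self c).symm⟩
  convert hQ.sum_nonneg c x using 2
  simp only [dotProduct, Matrix.mulVec, Finset.mul_sum, Matrix.of_apply, Pi.star_apply,
    RCLike.star_def]
  exact Finset.sum_congr rfl fun j _ => Finset.sum_congr rfl fun i _ => by ring

open scoped ComplexOrder in
theorem ClassQ.norm_sq_le {ψ : ℂ × ℂ → ℂ × ℂ}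
    (hQ : ClassQ (fun z => (ψ z).1) (fun z => (ψ z).2) (fun z => (ψ z).1 * (ψ z).2))
    {z w : ℂ × ℂ} (hz : z ∈ bidisk) (hw : w ∈ bidisk) :
    quotientKernel ψ z w * quotientKernel ψ w z ≤
      quotientKernel ψ z z * quotientKernel ψ w w := by
  have h := (hQ.posSemidef ![(⟨z, hz⟩ : bidisk), ⟨w, hw⟩]).det_nonneg
  rw [Matrix.det_fin_two] at h
  simpa using h

open scoped ComplexOrder in
-- The vector `(K(w, w), -K(w, z), 0)` is isotropic for the positive matrix of `K` at `z, w, u` when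
-- the minor at `z, w` vanishes. An isotropic vector of a positive semidefinite matrix lies in its
-- kernel, and the row of `u` is the claim.
theorem ClassQ.mul_eq_of_eq {ψ : ℂ × ℂ → ℂ × ℂ}
    (hQ : ClassQ (fun z => (ψ z).1) (fun z => (ψ z).2) (fun z => (ψ z).1 * (ψ z).2))
    {z w u : ℂ × ℂ} (hz : z ∈ bidisk) (hw : w ∈ bidisk) (hu : u ∈ bidisk)
    (h : quotientKernel ψ z w * quotientKernel ψ w z =
      quotientKernel ψ z z * quotientKernel ψ w w) :
    quotientKernel ψ u z * quotientKernel ψ w w =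
      quotientKernel ψ u w * quotientKernel ψ w z := by
  have hP := hQ.posSemidef ![(⟨z, hz⟩ : bidisk), ⟨w, hw⟩, ⟨u, hu⟩]
  have h0 := (hP.dotProduct_mulVec_zero_iff
    ![quotientKernel ψ w w, -quotientKernel ψ w z, 0]).1 (by
      simp [dotProduct, Matrix.mulVec, Fin.sum_univ_three, conj_quotientKernel]
      linear_combination -quotientKernel ψ w w * h)
  have := congrFun h0 2
  simp [dotProduct, Matrix.mulVec, Fin.sum_univ_three] at this
  linear_combination this

/-! ### Blaschke factors and the distance -/

/-- The quantity under the square root in `dist₂`. -/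
noncomputable def distSq (z w : ℂ × ℂ) : ℝ :=
  ‖blaschke w.1 z.1‖ ^ 2 + ‖blaschke w.2 z.2‖ ^ 2 - ‖blaschke w.1 z.1 * blaschke w.2 z.2‖ ^ 2

theorem one_sub_blaschke_mul_conj {a x y : ℂ} (ha : ‖a‖ < 1) (hx : ‖x‖ < 1) (hy : ‖y‖ < 1) :
    1 - blaschke a x * conj (blaschke a y) =
      (1 - a * conj a) * (1 - x * conj y) / ((1 - x * conj a) * (1 - a * conj y)) := by
  have h1 := one_sub_mul_conj_ne_zero hx ha
  have h2 := one_sub_mul_conj_ne_zero ha hy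
  have h3 : 1 - conj a * x ≠ 0 := by rwa [mul_comm]
  simp only [blaschke, map_div₀, map_sub, map_one, map_mul, Complex.conj_conj]
  rw [mul_comm (conj a) x, div_mul_div_comm, one_sub_div (mul_ne_zero h1 h2)]
  congr 1
  ring

theorem blaschke_norm_lt_one {a x : ℂ} (ha : ‖a‖ < 1) (hx : ‖x‖ < 1) : ‖blaschke a x‖ < 1 := by
  have h := one_sub_blaschke_mul_conj ha hx hx
  have h1 := one_sub_mul_conj_ne_zero hx ha
  have h2 : (1 - x * conj a) * (1 - a * conj x) = ((‖1 - x * conj a‖ ^ 2 : ℝ) : ℂ) := by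
    push_cast
    rw [← Complex.mul_conj']
    simp [mul_comm]
  rw [h2, Complex.mul_conj', Complex.mul_conj', Complex.mul_conj'] at h
  norm_cast at h
  have h3 : 0 < 1 - ‖blaschke a x‖ ^ 2 := by
    rw [h]
    have h4 : ‖x‖ ^ 2 < 1 := pow_lt_one₀ (norm_nonneg _) hx two_ne_zero
    have h5 : ‖a‖ ^ 2 < 1 := pow_lt_one₀ (norm_nonneg _) ha two_ne_zero
    have h6 : 0 < ‖1 - x * conj a‖ := norm_pos_iff.2 h1
    have : 0 < 1 - ‖a‖ ^ 2 := by linarith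
    have : 0 < 1 - ‖x‖ ^ 2 := by linarith
    positivity
  exact (sq_lt_one_iff₀ (norm_nonneg _)).1 (by linarith)

theorem blaschke_neg_blaschke {a x : ℂ} (ha : ‖a‖ < 1) (hx : ‖x‖ < 1) :
    blaschke (-a) (blaschke a x) = x := by
  have h1 : 1 - conj a * x ≠ 0 := by rw [mul_comm]; exact one_sub_mul_conj_ne_zero hx ha
  have h2 : 1 - conj a * a ≠ 0 := by rw [mul_comm]; exact one_sub_mul_conj_ne_zero ha ha
  have h3 : 1 - conj (-a) * blaschke a x = (1 - conj a * a) / (1 - conj a * x) := by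
    rw [blaschke, map_neg, eq_div_iff h1]
    field_simp
    ring
  rw [blaschke, h3, div_eq_iff (div_ne_zero h2 h1), blaschke]
  generalize conj a = b at h1 h2 ⊢
  rw [sub_neg_eq_add, div_add' _ _ _ h1, mul_div_assoc']
  congr 1
  ring

theorem differentiableOn_blaschke {a : ℂ} (ha : ‖a‖ < 1) :
    DifferentiableOn ℂ (blaschke a) {x | ‖x‖ < 1} := by
  refine DifferentiableOn.div (by fun_prop) (by fun_prop) fun x hx => ?_
  rw [mul_comm]
  exact one_sub_mul_conj_ne_zero hx ha

/-- The automorphism `z ↦ (b_{a₁}(z₁), b_{a₂}(z₂))` of the bidisk. -/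
noncomputable def blaschkeMap (a z : ℂ × ℂ) : ℂ × ℂ := (blaschke a.1 z.1, blaschke a.2 z.2)

/-- Product over the two coordinates of `one_sub_blaschke_mul_conj`: an automorphism changes `szego`
only by a factor in `x` and a factor in `y`. -/
theorem szego_blaschkeMap {a x y : ℂ × ℂ} (ha : a ∈ bidisk) (hx : x ∈ bidisk) (hy : y ∈ bidisk) :
    szego (blaschkeMap a x) (blaschkeMap a y) =
      szego a a * szego x y / (szego x a * szego a y) := by
  simp only [szego, blaschkeMap, one_sub_blaschke_mul_conj ha.1 hx.1 hy.1,
    one_sub_blaschke_mul_conj ha.2 hx.2 hy.2]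
  rw [div_mul_div_comm]
  congr 1 <;> ring

theorem isHolSelfMap_blaschkeMap {a : ℂ × ℂ} (ha : a ∈ bidisk) : IsHolSelfMap (blaschkeMap a) := by
  refine ⟨?_, fun z hz => ⟨blaschke_norm_lt_one ha.1 hz.1, blaschke_norm_lt_one ha.2 hz.2⟩⟩
  exact ((differentiableOn_blaschke ha.1).comp differentiableOn_fst fun z hz => hz.1).prodMk
    ((differentiableOn_blaschke ha.2).comp differentiableOn_snd fun z hz => hz.2)

theorem neg_mem_bidisk {a : ℂ × ℂ} (ha : a ∈ bidisk) : -a ∈ bidisk := by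
  simpa [bidisk] using ha

theorem blaschkeMap_neg_blaschkeMap {a z : ℂ × ℂ} (ha : a ∈ bidisk) (hz : z ∈ bidisk) :
    blaschkeMap (-a) (blaschkeMap a z) = z :=
  Prod.ext (blaschke_neg_blaschke ha.1 hz.1) (blaschke_neg_blaschke ha.2 hz.2)

theorem blaschkeMap_blaschkeMap_neg {a z : ℂ × ℂ} (ha : a ∈ bidisk) (hz : z ∈ bidisk) :
    blaschkeMap a (blaschkeMap (-a) z) = z := by
  simpa using blaschkeMap_neg_blaschkeMap (neg_mem_bidisk ha) hz

theorem one_sub_distSq (z w : ℂ × ℂ) :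
    ((1 - distSq z w : ℝ) : ℂ) = szego (blaschkeMap w z) (blaschkeMap w z) := by
  rw [szego_self, distSq, blaschkeMap, norm_mul]
  congr 1
  ring

theorem distSq_lt_one {z w : ℂ × ℂ} (hz : z ∈ bidisk) (hw : w ∈ bidisk) : distSq z w < 1 := by
  have h := one_sub_distSq z w
  rw [szego_self] at h
  have := szego_self_pos ((isHolSelfMap_blaschkeMap hw).2 hz)
  have h' := Complex.ofReal_injective h
  linarith

theorem distSq_nonneg {z w : ℂ × ℂ} (hz : z ∈ bidisk) (hw : w ∈ bidisk) : 0 ≤ distSq z w := by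
  have h2 := ((isHolSelfMap_blaschkeMap hw).2 hz).2
  have h3 : ‖blaschke w.2 z.2‖ ^ 2 ≤ 1 := pow_le_one₀ (norm_nonneg _) h2.le
  rw [distSq, norm_mul]
  nlinarith [sq_nonneg ‖blaschke w.1 z.1‖, sq_nonneg ‖blaschke w.2 z.2‖]

/-! ### The contraction inequality -/

/-- Both sides come from `1 - d(z, w)² = s(z, z) s(w, w) / (s(z, w) s(w, z))`, applied to `(z, w)`
and to `(ψ z, ψ w)`. It translates comparison of distances into the sign of a 2 × 2 minor of `K`. -/
theorem quotientKernel_mul_one_sub_distSq {ψ : ℂ × ℂ → ℂ × ℂ} (hψ : Set.MapsTo ψ bidisk bidisk)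
    {z w : ℂ × ℂ} (hz : z ∈ bidisk) (hw : w ∈ bidisk) :
    quotientKernel ψ z w * quotientKernel ψ w z * ((1 - distSq (ψ z) (ψ w) : ℝ) : ℂ) =
      quotientKernel ψ z z * quotientKernel ψ w w * ((1 - distSq z w : ℝ) : ℂ) := by
  have hz' := hψ hz
  have hw' := hψ hw
  rw [one_sub_distSq, one_sub_distSq, szego_blaschkeMap hw hz hz, szego_blaschkeMap hw' hz' hz']
  simp only [quotientKernel]
  have h1 := szego_ne_zero hz hz
  have h2 := szego_ne_zero hw hw
  have h3 := szego_ne_zero hz hw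
  have h4 := szego_ne_zero hw hz
  have h5 := szego_ne_zero hz' hw'
  have h6 := szego_ne_zero hw' hz'
  field_simp

theorem quotientKernel_mul_swap (ψ : ℂ × ℂ → ℂ × ℂ) (z w : ℂ × ℂ) :
    quotientKernel ψ z w * quotientKernel ψ w z = ((‖quotientKernel ψ z w‖ ^ 2 : ℝ) : ℂ) := by
  rw [← conj_quotientKernel ψ z w, Complex.mul_conj']
  push_cast
  rfl

theorem quotientKernel_ne_zero {ψ : ℂ × ℂ → ℂ × ℂ} (hψ : Set.MapsTo ψ bidisk bidisk)
    {z w : ℂ × ℂ} (hz : z ∈ bidisk) (hw : w ∈ bidisk) : quotientKernel ψ z w ≠ 0 :=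
  div_ne_zero (szego_ne_zero (hψ hz) (hψ hw)) (szego_ne_zero hz hw)

open scoped ComplexOrder in
theorem ClassQ.distSq_le {ψ : ℂ × ℂ → ℂ × ℂ} (hψ : Set.MapsTo ψ bidisk bidisk)
    (hQ : ClassQ (fun z => (ψ z).1) (fun z => (ψ z).2) (fun z => (ψ z).1 * (ψ z).2))
    {z w : ℂ × ℂ} (hz : z ∈ bidisk) (hw : w ∈ bidisk) :
    distSq (ψ z) (ψ w) ≤ distSq z w := by
  have h1 := quotientKernel_mul_one_sub_distSq hψ hz hw
  have h2 := hQ.norm_sq_le hz hw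
  have h3 : (0 : ℂ) ≤ ((1 - distSq z w : ℝ) : ℂ) :=
    Complex.zero_le_real.2 (by linarith [distSq_lt_one hz hw])
  have h4 := mul_le_mul_of_nonneg_right h2 h3
  rw [← h1, quotientKernel_mul_swap] at h4
  have h5 : 0 < ‖quotientKernel ψ z w‖ ^ 2 :=
    pow_pos (norm_pos_iff.2 (quotientKernel_ne_zero hψ hz hw)) 2
  rw [← Complex.ofReal_mul, ← Complex.ofReal_mul, Complex.real_le_real] at h4
  have := le_of_mul_le_mul_left h4 h5
  linarith

theorem quotientKernel_mul_eq_of_distSq_eq {ψ : ℂ × ℂ → ℂ × ℂ} (hψ : Set.MapsTo ψ bidisk bidisk)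
    {z w : ℂ × ℂ} (hz : z ∈ bidisk) (hw : w ∈ bidisk) (h : distSq (ψ z) (ψ w) = distSq z w) :
    quotientKernel ψ z w * quotientKernel ψ w z =
      quotientKernel ψ z z * quotientKernel ψ w w := by
  have h1 := quotientKernel_mul_one_sub_distSq hψ hz hw
  rw [h] at h1
  refine mul_right_cancel₀ (Complex.ofReal_ne_zero.2 ?_) h1
  linarith [distSq_lt_one hz hw]

/-! ### The equality case: the quotient kernel has rank one -/

theorem isOpen_bidisk : IsOpen bidisk :=
  (isOpen_lt continuous_fst.norm continuous_const).inter
    (isOpen_lt continuous_snd.norm continuous_const)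

theorem convex_bidisk : Convex ℝ bidisk := by
  have : bidisk = Metric.ball (0 : ℂ) 1 ×ˢ Metric.ball (0 : ℂ) 1 := by
    ext z
    simp [bidisk]
  rw [this]
  exact (convex_ball _ _).prod (convex_ball _ _)

/-- The identity theorem for holomorphic functions on a convex open set. -/
theorem eqOn_zero_of_convex {E : Type*} [NormedAddCommGroup E] [NormedSpace ℂ E]
    [NormedSpace ℝ E] [IsScalarTower ℝ ℂ E] {U V : Set E}
    (hU : IsOpen U) (hc : Convex ℝ U) (hV : IsOpen V) (hne : V.Nonempty) (hVU : V ⊆ U)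
    {F : E → ℂ} (hF : DifferentiableOn ℂ F U) (h0 : Set.EqOn F 0 V) : Set.EqOn F 0 U := by
  obtain ⟨v, hv⟩ := hne
  intro z hz
  -- Restriction to the complex line through `v` and `z` reduces the claim to one variable;
  -- convexity of `U` makes its trace on the line connected.
  set g : ℂ → E := fun t => v + t • (z - v) with hg
  have hgc : Differentiable ℂ g := by fun_prop
  have ho : IsOpen (g ⁻¹' U) := hU.preimage hgc.continuous
  have hconv : Convex ℝ (g ⁻¹' U) := by
    intro s hs t ht a b ha hb hab
    have := hc hs ht ha hb hab
    rw [Set.mem_preimage]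
    convert this using 1
    simp only [hg, smul_add, add_smul, smul_assoc]
    rw [add_add_add_comm, ← add_smul, hab, one_smul]
  have hd : DifferentiableOn ℂ (F ∘ g) (g ⁻¹' U) :=
    hF.comp hgc.differentiableOn (Set.mapsTo_preimage g U)
  have h00 : (0 : ℂ) ∈ g ⁻¹' V := by simpa [hg] using hv
  have h1 := (hd.analyticOnNhd ho).eqOn_zero_of_preconnected_of_eventuallyEq_zero
    hconv.isPreconnected (hVU h00) (Filter.mem_of_superset
      ((hV.preimage hgc.continuous).mem_nhds h00) fun t ht => h0 ht)
  simpa [hg] using h1 (show (1 : ℂ) ∈ g ⁻¹' U by simpa [hg] using hz)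

theorem differentiableOn_szego_left {ψ : ℂ × ℂ → ℂ × ℂ} (hψ : DifferentiableOn ℂ ψ bidisk)
    (w : ℂ × ℂ) : DifferentiableOn ℂ (fun z => szego (ψ z) w) bidisk := by
  unfold szego
  fun_prop

theorem differentiableOn_quotientKernel {ψ : ℂ × ℂ → ℂ × ℂ} (hψ : DifferentiableOn ℂ ψ bidisk)
    {w : ℂ × ℂ} (hw : w ∈ bidisk) :
    DifferentiableOn ℂ (fun z => quotientKernel ψ z w) bidisk := by
  simp only [quotientKernel, div_eq_mul_inv]
  exact (differentiableOn_szego_left hψ _).fun_mul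
    ((differentiableOn_szego_left differentiableOn_id w).fun_inv fun _ hz => szego_ne_zero hz hw)

theorem quotientKernel_rank_one {ψ : ℂ × ℂ → ℂ × ℂ} (hψ : IsHolSelfMap ψ)
    (hQ : ClassQ (fun z => (ψ z).1) (fun z => (ψ z).2) (fun z => (ψ z).1 * (ψ z).2))
    {w : ℂ × ℂ} (hw : w ∈ bidisk) {V : Set (ℂ × ℂ)} (hV : IsOpen V) (hne : V.Nonempty)
    (hVU : V ⊆ bidisk) (h : ∀ z ∈ V, distSq (ψ z) (ψ w) = distSq z w)
    {z u : ℂ × ℂ} (hz : z ∈ bidisk) (hu : u ∈ bidisk) :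
    quotientKernel ψ z u * quotientKernel ψ w w =
      quotientKernel ψ z w * quotientKernel ψ w u := by
  have key := eqOn_zero_of_convex isOpen_bidisk convex_bidisk hV hne hVU
    (F := fun z => quotientKernel ψ z u * quotientKernel ψ w w -
      quotientKernel ψ z w * quotientKernel ψ w u)
    (((differentiableOn_quotientKernel hψ.1 hu).mul_const _).sub
      ((differentiableOn_quotientKernel hψ.1 hw).mul_const _)) fun z hzV => by
    -- Conjugation puts `z` into the first slot, where the kernel is holomorphic.
    have := congrArg conj (hQ.mul_eq_of_eq (hVU hzV) hw hu
      (quotientKernel_mul_eq_of_distSq_eq hψ.2 (hVU hzV) hw (h z hzV)))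
    simp only [map_mul, conj_quotientKernel] at this
    simp only [Pi.zero_apply]
    linear_combination this
  exact sub_eq_zero.1 (key hz)

/-- By `szego_blaschkeMap` the quotient of the two sides is `K(z, u) K(w, w) / (K(z, w) K(w, u))`,
which the rank one identity sets equal to 1. -/
theorem szego_blaschkeMap_eq {ψ : ℂ × ℂ → ℂ × ℂ} (hψ : Set.MapsTo ψ bidisk bidisk)
    {w z u : ℂ × ℂ} (hw : w ∈ bidisk) (hz : z ∈ bidisk) (hu : u ∈ bidisk)
    (h : quotientKernel ψ z u * quotientKernel ψ w w =
      quotientKernel ψ z w * quotientKernel ψ w u) :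
    szego (blaschkeMap (ψ w) (ψ z)) (blaschkeMap (ψ w) (ψ u)) =
      szego (blaschkeMap w z) (blaschkeMap w u) := by
  rw [szego_blaschkeMap hw hz hu, szego_blaschkeMap (hψ hw) (hψ hz) (hψ hu)]
  have h2 := szego_ne_zero hw hw
  have h3 := szego_ne_zero hz hw
  have h4 := szego_ne_zero hw hu
  have h5 := szego_ne_zero hz hu
  have h6 := szego_ne_zero (hψ hz) (hψ hw)
  have h7 := szego_ne_zero (hψ hw) (hψ hu)
  simp only [quotientKernel] at h
  field_simp at h ⊢
  linear_combination h

/-! ### Maps that preserve `szego` -/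

/-- The vector `(z₁, z₂, z₁ z₂)`. -/
def monomialVec (z : ℂ × ℂ) : Fin 3 → ℂ := ![z.1, z.2, z.1 * z.2]

open Matrix in
theorem szego_eq_one_sub_dotProduct (z u : ℂ × ℂ) :
    szego z u = 1 - monomialVec z ⬝ᵥ (diagonal ![1, 1, -1] *ᵥ star (monomialVec u)) := by
  simp [szego, monomialVec, dotProduct, Matrix.mulVec_diagonal, Fin.sum_univ_three]
  ring

open Matrix in
/-- A map preserving `szego` is linear in the monomials `z₁, z₂, z₁ z₂`. -/
theorem exists_matrix_of_szego_eq {φ : ℂ × ℂ → ℂ × ℂ}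
    (h : ∀ z ∈ bidisk, ∀ u ∈ bidisk, szego (φ z) (φ u) = szego z u) :
    ∃ U : Matrix (Fin 3) (Fin 3) ℂ, ∀ z ∈ bidisk,
      monomialVec (φ z) = monomialVec z ᵥ* U := by
  -- Three points whose monomial vectors are linearly independent, so that `M` below is invertible.
  set p : Fin 3 → ℂ × ℂ := ![(1 / 2, 0), (0, 1 / 2), (1 / 2, 1 / 2)] with hp
  have hpm : ∀ i, p i ∈ bidisk := by
    intro i
    fin_cases i <;> norm_num [hp, bidisk]
  set J : Matrix (Fin 3) (Fin 3) ℂ := diagonal ![1, 1, -1] with hJ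
  set M : Matrix (Fin 3) (Fin 3) ℂ := of fun i => monomialVec (p i) with hM
  set N : Matrix (Fin 3) (Fin 3) ℂ := of fun i => monomialVec (φ (p i)) with hN
  have key : ∀ z ∈ bidisk, monomialVec (φ z) ᵥ* (J * Nᴴ) = monomialVec z ᵥ* (J * Mᴴ) := by
    intro z hz
    funext i
    have h1 := h z hz (p i) (hpm i)
    rw [szego_eq_one_sub_dotProduct, szego_eq_one_sub_dotProduct] at h1
    rw [← vecMul_vecMul, ← vecMul_vecMul]
    rw [dotProduct_mulVec, dotProduct_mulVec] at h1
    exact sub_right_injective h1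
  -- At the sample points the relation equates two Gram matrices. The right one is invertible, hence
  -- so is `J * Nᴴ`, and `key` can be solved for `monomialVec (φ z)`.
  have hMN : N * (J * Nᴴ) = M * (J * Mᴴ) := by
    ext i j
    exact congrFun (key (p i) (hpm i)) j
  have hJd : J.det ≠ 0 := by simp [hJ, det_diagonal, Fin.prod_univ_three]
  have hMd : M.det ≠ 0 := by
    rw [det_fin_three]
    simp [hM, hp, monomialVec]
  have hNd : IsUnit (J * Nᴴ).det := by
    refine isUnit_iff_ne_zero.2 fun h0 => ?_
    have := congrArg det hMN
    rw [det_mul, h0, mul_zero, det_mul, det_mul, det_conjTranspose] at this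
    exact mul_ne_zero hMd (mul_ne_zero hJd (star_ne_zero.2 hMd)) this.symm
  refine ⟨J * Mᴴ * (J * Nᴴ)⁻¹, fun z hz => ?_⟩
  rw [← vecMul_vecMul, ← key z hz, vecMul_vecMul, mul_nonsing_inv _ hNd, vecMul_one]

/-- The coefficients of `z₁²`, `z₂²`, `z₁²z₂` and `z₁z₂²` on the left have no counterpart on the
right. Parity in each variable isolates them from values at points with coordinates in `{0, ±1/2}`.
-/
theorem eq_zero_of_bidisk_identity {a b c a' b' c' p q r : ℂ}
    (h : ∀ z ∈ bidisk, (a * z.1 + b * z.2 + c * (z.1 * z.2)) *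
      (a' * z.1 + b' * z.2 + c' * (z.1 * z.2)) = p * z.1 + q * z.2 + r * (z.1 * z.2)) :
    a * a' = 0 ∧ b * b' = 0 ∧ a * c' + c * a' = 0 ∧ b * c' + c * b' = 0 := by
  have h1 := h (1 / 2, 0) (by norm_num [bidisk])
  have h2 := h (-(1 / 2), 0) (by norm_num [bidisk])
  have h3 := h (0, 1 / 2) (by norm_num [bidisk])
  have h4 := h (0, -(1 / 2)) (by norm_num [bidisk])
  have h5 := h (1 / 2, 1 / 2) (by norm_num [bidisk])
  have h6 := h (1 / 2, -(1 / 2)) (by norm_num [bidisk])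
  have h7 := h (-(1 / 2), 1 / 2) (by norm_num [bidisk])
  have h8 := h (-(1 / 2), -(1 / 2)) (by norm_num [bidisk])
  simp only [mul_zero, add_zero, zero_mul, zero_add] at h1 h2 h3 h4
  have e1 : a * a' = 0 := by linear_combination 2 * h1 + 2 * h2
  have e2 : b * b' = 0 := by linear_combination 2 * h3 + 2 * h4
  have e3 : p = 0 := by linear_combination h2 - h1
  have e4 : q = 0 := by linear_combination h4 - h3
  subst e3 e4
  refine ⟨e1, e2, ?_, ?_⟩
  · linear_combination 2 * (h5 - h6 + h7 - h8)
  · linear_combination 2 * (h5 + h6 - h7 - h8)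

theorem eq_diagonal_or_swap_of_szego_eq {φ : ℂ × ℂ → ℂ × ℂ}
    (h : ∀ z ∈ bidisk, ∀ u ∈ bidisk, szego (φ z) (φ u) = szego z u) :
    ∃ α β : ℂ, ‖α‖ = 1 ∧ ‖β‖ = 1 ∧ ((∀ z ∈ bidisk, φ z = (α * z.1, β * z.2)) ∨
      (∀ z ∈ bidisk, φ z = (α * z.2, β * z.1))) := by
  obtain ⟨U, hU⟩ := exists_matrix_of_szego_eq h
  obtain ⟨a, ha⟩ : ∃ a, U 0 0 = a := ⟨_, rfl⟩
  obtain ⟨b, hb⟩ : ∃ a, U 1 0 = a := ⟨_, rfl⟩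
  obtain ⟨c, hc⟩ : ∃ a, U 2 0 = a := ⟨_, rfl⟩
  obtain ⟨a', ha'⟩ : ∃ a, U 0 1 = a := ⟨_, rfl⟩
  obtain ⟨b', hb'⟩ : ∃ a, U 1 1 = a := ⟨_, rfl⟩
  obtain ⟨c', hc'⟩ : ∃ a, U 2 1 = a := ⟨_, rfl⟩
  have h1 : ∀ z ∈ bidisk, (φ z).1 = a * z.1 + b * z.2 + c * (z.1 * z.2) := fun z hz => by
    have := congrFun (hU z hz) 0
    simp [monomialVec, Matrix.vecMul, dotProduct, Fin.sum_univ_three, ha, hb, hc] at this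
    linear_combination this
  have h2 : ∀ z ∈ bidisk, (φ z).2 = a' * z.1 + b' * z.2 + c' * (z.1 * z.2) := fun z hz => by
    have := congrFun (hU z hz) 1
    simp [monomialVec, Matrix.vecMul, dotProduct, Fin.sum_univ_three, ha', hb', hc'] at this
    linear_combination this
  obtain ⟨e1, e2, e3, e4⟩ := eq_zero_of_bidisk_identity
    (a := a) (b := b) (c := c) (a' := a') (b' := b') (c' := c')
    (p := U 0 2) (q := U 1 2) (r := U 2 2) fun z hz => by
      rw [← h1 z hz, ← h2 z hz]
      have := congrFun (hU z hz) 2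
      simp [monomialVec, Matrix.vecMul, dotProduct, Fin.sum_univ_three] at this
      linear_combination this
  have m1 : ((1 / 2, 0) : ℂ × ℂ) ∈ bidisk := by norm_num [bidisk]
  have m2 : ((0, 1 / 2) : ℂ × ℂ) ∈ bidisk := by norm_num [bidisk]
  have g1 := h _ m1 _ m1
  have g2 := h _ m2 _ m2
  have g3 := h _ m1 _ m2
  simp only [szego, h1 _ m1, h2 _ m1, h1 _ m2, h2 _ m2, mul_zero, add_zero, zero_mul, zero_add,
    map_mul, map_div₀, map_one, map_ofNat, map_zero] at g1 g2 g3
  -- The quartic term of `g1` contains `a * a'`, which vanishes by `e1`.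
  have n1 : a * conj a + a' * conj a' = 1 := by
    linear_combination (1 / 4) * conj a * conj a' * e1 - 4 * g1
  have n2 : b * conj b + b' * conj b' = 1 := by
    linear_combination (1 / 4) * conj b * conj b' * e2 - 4 * g2
  have unim : ∀ x : ℂ, x * conj x = 1 → ‖x‖ = 1 := fun x hx => by
    rw [Complex.mul_conj'] at hx
    have : ‖x‖ ^ 2 = 1 := by exact_mod_cast hx
    exact (pow_eq_one_iff_of_nonneg (norm_nonneg x) two_ne_zero).1 this
  -- If `a = b = 0` or `a' = b' = 0`, then `n1` and `n2` make the two remaining linear coefficients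
  -- unimodular, while `g3` forces their product to vanish. The mixed cases are the swap and the
  -- diagonal one, where `e3` and `e4` remove `c` and `c'`.
  rcases mul_eq_zero.1 e1 with rfl | rfl <;> rcases mul_eq_zero.1 e2 with rfl | rfl
  · simp at n1 n2 g3
    exact absurd g3 (by
      rintro (h | h) <;> simp [h] at n1 n2)
  · have c0 : c = 0 := by
      have : a' ≠ 0 := by rintro rfl; simp at n1
      simpa [this] using e3
    have c0' : c' = 0 := by
      have : b ≠ 0 := by rintro rfl; simp at n2
      simpa [this] using e4
    subst c0 c0'
    exact ⟨b, a', unim b (by simpa using n2), unim a' (by simpa using n1), Or.inr fun z hz =>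
      Prod.ext (by simp [h1 z hz]) (by simp [h2 z hz])⟩
  · have c0' : c' = 0 := by
      have : a ≠ 0 := by rintro rfl; simp at n1
      simpa [this] using e3
    have c0 : c = 0 := by
      have : b' ≠ 0 := by rintro rfl; simp at n2
      simpa [this] using e4
    subst c0 c0'
    exact ⟨a, b', unim a (by simpa using n1), unim b' (by simpa using n2), Or.inl fun z hz =>
      Prod.ext (by simp [h1 z hz]) (by simp [h2 z hz])⟩
  · simp at n1 n2 g3
    exact absurd g3 (by
      rintro (h | h) <;> simp [h] at n1 n2)

/-! ### Automorphisms of the bidisk and the rigidity statement -/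

theorem IsAut.comp {f g : ℂ × ℂ → ℂ × ℂ} (hf : IsAut f) (hg : IsAut g) : IsAut (f ∘ g) := by
  obtain ⟨⟨hf1, hf2⟩, f', ⟨hf1', hf2'⟩, hf3, hf4⟩ := hf
  obtain ⟨⟨hg1, hg2⟩, g', ⟨hg1', hg2'⟩, hg3, hg4⟩ := hg
  exact ⟨⟨hf1.comp hg1 hg2, hf2.comp hg2⟩, g' ∘ f', ⟨hg1'.comp hf1' hf2', hg2'.comp hf2'⟩,
    fun z hz => by simp only [Function.comp_apply, hf3 (hg2 hz), hg3 hz],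
    fun z hz => by simp only [Function.comp_apply, hg4 (hf2' hz), hf4 hz]⟩

theorem IsAut.congr {f g : ℂ × ℂ → ℂ × ℂ} (hf : IsAut f) (h : Set.EqOn g f bidisk) : IsAut g := by
  obtain ⟨⟨hf1, hf2⟩, f', hf', hf3, hf4⟩ := hf
  exact ⟨⟨hf1.congr h, hf2.congr h.symm⟩, f', hf', fun z hz => by rw [h hz, hf3 hz],
    fun z hz => by rw [h (hf'.2 hz), hf4 hz]⟩

theorem isAut_blaschkeMap {a : ℂ × ℂ} (ha : a ∈ bidisk) : IsAut (blaschkeMap a) :=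
  ⟨isHolSelfMap_blaschkeMap ha, blaschkeMap (-a), isHolSelfMap_blaschkeMap (neg_mem_bidisk ha),
    fun _ hz => blaschkeMap_neg_blaschkeMap ha hz, fun _ hz => blaschkeMap_blaschkeMap_neg ha hz⟩

theorem isHolSelfMap_rotation {α β : ℂ} (hα : ‖α‖ = 1) (hβ : ‖β‖ = 1) :
    IsHolSelfMap fun z => (α * z.1, β * z.2) :=
  ⟨by fun_prop, fun z hz => ⟨by simpa [hα] using hz.1, by simpa [hβ] using hz.2⟩⟩

theorem isAut_rotation {α β : ℂ} (hα : ‖α‖ = 1) (hβ : ‖β‖ = 1) :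
    IsAut fun z => (α * z.1, β * z.2) := by
  have hα0 : α ≠ 0 := norm_ne_zero_iff.1 (by simp [hα])
  have hβ0 : β ≠ 0 := norm_ne_zero_iff.1 (by simp [hβ])
  exact ⟨isHolSelfMap_rotation hα hβ, fun z => (α⁻¹ * z.1, β⁻¹ * z.2),
    isHolSelfMap_rotation (by simp [hα]) (by simp [hβ]),
    fun z _ => by simp [hα0, hβ0], fun z _ => by simp [hα0, hβ0]⟩

theorem isAut_swap : IsAut Prod.swap :=
  have h : IsHolSelfMap Prod.swap := ⟨(differentiable_snd.prodMk differentiable_fst).differentiableOn,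
    fun _ hz => ⟨hz.2, hz.1⟩⟩
  ⟨h, Prod.swap, h, fun z _ => Prod.swap_swap z, fun z _ => Prod.swap_swap z⟩

theorem isAut_of_szego_eq {φ : ℂ × ℂ → ℂ × ℂ}
    (h : ∀ z ∈ bidisk, ∀ u ∈ bidisk, szego (φ z) (φ u) = szego z u) : IsAut φ := by
  obtain ⟨α, β, hα, hβ, h | h⟩ := eq_diagonal_or_swap_of_szego_eq h
  · exact (isAut_rotation hα hβ).congr h
  · exact ((isAut_rotation hα hβ).comp isAut_swap).congr h

/-- The map is normalised to send the origin to itself, recognised as an automorphism because it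
preserves `szego`, and `ψ` is recovered by undoing the two Blaschke maps. -/
theorem isAut_of_distSq_eq {ψ : ℂ × ℂ → ℂ × ℂ} (hψ : IsHolSelfMap ψ)
    (hQ : ClassQ (fun z => (ψ z).1) (fun z => (ψ z).2) (fun z => (ψ z).1 * (ψ z).2))
    {w : ℂ × ℂ} (hw : w ∈ bidisk) {V : Set (ℂ × ℂ)} (hV : IsOpen V) (hne : V.Nonempty)
    (hVU : V ⊆ bidisk) (h : ∀ z ∈ V, distSq (ψ z) (ψ w) = distSq z w) : IsAut ψ := by
  have hw' := neg_mem_bidisk hw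
  have hφ : IsAut (blaschkeMap (ψ w) ∘ ψ ∘ blaschkeMap (-w)) := by
    refine isAut_of_szego_eq fun z hz u hu => ?_
    have hz' := (isHolSelfMap_blaschkeMap hw').2 hz
    have hu' := (isHolSelfMap_blaschkeMap hw').2 hu
    have := szego_blaschkeMap_eq hψ.2 hw hz' hu'
      (quotientKernel_rank_one hψ hQ hw hV hne hVU h hz' hu')
    rwa [blaschkeMap_blaschkeMap_neg hw hz, blaschkeMap_blaschkeMap_neg hw hu] at this
  refine (((isAut_blaschkeMap (neg_mem_bidisk (hψ.2 hw))).comp hφ).comp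
    (isAut_blaschkeMap hw)).congr fun z hz => ?_
  simp only [Function.comp_apply, blaschkeMap_neg_blaschkeMap hw hz,
    blaschkeMap_neg_blaschkeMap (hψ.2 hw) (hψ.2 hz)]

end BidiskHardy

theorem mainTheorem2 (ψ : ℂ × ℂ → ℂ × ℂ) (hψ : BidiskHardy.IsHolSelfMap ψ)
    (hQ : BidiskHardy.ClassQ (fun z => (ψ z).1) (fun z => (ψ z).2)
      (fun z => (ψ z).1 * (ψ z).2)) :
    (∀ z ∈ BidiskHardy.bidisk, ∀ w ∈ BidiskHardy.bidisk,
      0 ≤ BidiskHardy.dist₂ (ψ z) (ψ w) ∧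
      BidiskHardy.dist₂ (ψ z) (ψ w) ≤ BidiskHardy.dist₂ z w ∧
      BidiskHardy.dist₂ z w < 1) ∧
    (∀ w ∈ BidiskHardy.bidisk, ∀ V : Set (ℂ × ℂ),
      IsOpen V → V.Nonempty → V ⊆ BidiskHardy.bidisk →
      (∀ z ∈ V, BidiskHardy.dist₂ (ψ z) (ψ w) = BidiskHardy.dist₂ z w) →
      BidiskHardy.IsAut ψ) := by
  refine ⟨fun z hz w hw => ⟨Real.sqrt_nonneg _, Real.sqrt_le_sqrt (hQ.distSq_le hψ.2 hz hw), ?_⟩,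
    fun w hw V hV hne hVU h => BidiskHardy.isAut_of_distSq_eq hψ hQ hw hV hne hVU fun z hz => ?_⟩
  · rw [BidiskHardy.dist₂, Real.sqrt_lt' one_pos, one_pow]
    exact BidiskHardy.distSq_lt_one hz hw
  · exact (Real.sqrt_inj (BidiskHardy.distSq_nonneg (hψ.2 (hVU hz)) (hψ.2 hw))
      (BidiskHardy.distSq_nonneg (hVU hz) hw)).1 (h z hz)
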